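/- For a Boolean function $f:\mathbb{Z}_2^n\to\mathbb{Z}_2$ and a permutation $\sigma$ of $\{1,\dots,n\}$ let $f_\sigma(x_1,\dots,x_n)=f(x_{\sigma(1)},\dots,x_{\sigma(n)})$. Two functions $g,h:\mathbb{Z}_2^n\to\mathbb{Z}_2$ are $\varepsilon$-close if $\Pr_x[g(x)\ne h(x)]\le\varepsilon$ for uniformly random $x\in\mathbb{Z}_2^n$. We say that $f$ can be locally corrected from noise rate $\varepsilon$ using $q$ non-adaptive queries if there is a randomized algorithm (which may depend on $f$) such that, for every permutation $\sigma$, every $g$ that is $\varepsilon$-close to $f_\sigma$ and every $x\in\mathbb{Z}_2^n$, the algorithm, given $x$ and black-box access to $g$, outputs $f_\sigma(x)$ with probability at least $2/3$ after querying $g$ at $q$ points (not necessarily distinct), all of which are chosen before any answer is seen. **Theorem.** Almost every Boolean function on $n$ variables cannot be locally corrected, even from a single error (i.e., from noise rate $\varepsilon=2^{-n}$), using fewer than $n/100$ non-adaptive queries. That is, the fraction of the functions $f:\mathbb{Z}_2^n\to\mathbb{Z}_2$ for which there is an integer $0\le q<n/100$ such that $f$ can be locally corrected from noise rate $2^{-n}$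 using $q$ non-adaptive queries tends to $0$ as $n\to\infty$. -/

import Mathlib

open Filter Topology

noncomputable section

namespace LocalCorrection

/-- The Boolean cube `ℤ₂ⁿ`. -/
abbrev Cube (n : ℕ) : Type := Fin n → ZMod 2

/-- Boolean functions `ℤ₂ⁿ → ℤ₂`. -/
abbrev BoolFun (n : ℕ) : Type := Cube n → ZMod 2

/-- The isomorphic copy `f_σ(x₁, …, xₙ) = f(x_{σ(1)}, …, x_{σ(n)})`. -/
def isoCopy {n : ℕ} (f : BoolFun n) (σ : Equiv.Perm (Fin n)) : BoolFun n :=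
  fun x => f (fun i => x (σ i))

/-- `f` and `g` are `ε`-close: `Pr_x[f x ≠ g x] ≤ ε` for uniformly random `x ∈ ℤ₂ⁿ`. -/
def IsClose {n : ℕ} (ε : ℝ) (f g : BoolFun n) : Prop :=
  (Set.ncard {x : Cube n | f x ≠ g x} : ℝ) / 2 ^ n ≤ ε

/-- A deterministic non-adaptive procedure with `q` queries: all query points are fixed before any
answer is seen (repetitions are allowed), and the output is a function of the vector of answers. -/
structure NonAdaptive (n q : ℕ) where
  /-- the points at which the input function is queried -/
  query : Fin q → Cube n
  /-- the output, given the answers to the queries -/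
  answer : (Fin q → ZMod 2) → ZMod 2

/-- The output of a non-adaptive procedure with black-box access to `g`. -/
def NonAdaptive.run {n q : ℕ} (D : NonAdaptive n q) (g : BoolFun n) : ZMod 2 :=
  D.answer (fun j => g (D.query j))

/-- A randomized non-adaptive algorithm with `q` queries: it is given a point `x` of the cube and
chooses, depending on `x` and on its random bits only, a deterministic non-adaptive procedure. -/
abbrev RandNonAdaptive (n q : ℕ) : Type := Cube n → PMF (NonAdaptive n q)

/-- The distribution of the output at the point `x` with black-box access to `g`. -/
def RandNonAdaptive.output {n q : ℕ} (A : RandNonAdaptive n q) (x : Cube n) (g : BoolFun n) :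
    PMF (ZMod 2) :=
  (A x).map (fun D => D.run g)

/-- `f` can be locally corrected from noise rate `ε` using `q` non-adaptive queries: there is a
randomized non-adaptive algorithm (which may depend on `f`) that, for every isomorphic copy `f_σ`
of `f`, every input function `g` that is `ε`-close to `f_σ` and every point `x`, outputs
`f_σ(x)` with probability at least `2/3`, using `q` queries to `g`. -/
def LocallyCorrectable {n : ℕ} (f : BoolFun n) (q : ℕ) (ε : ℝ) : Prop :=
  ∃ A : RandNonAdaptive n q, ∀ (σ : Equiv.Perm (Fin n)) (g : BoolFun n),
    IsClose ε g (isoCopy f σ) →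
      ∀ x : Cube n, 2 / 3 ≤ A.output x g (isoCopy f σ x)

/-- Almost every Boolean function on `n` variables satisfies `P`: the fraction of the functions
`ℤ₂ⁿ → ℤ₂` that do not satisfy it tends to zero as `n` tends to infinity. -/
def AlmostEveryBoolFun (P : ∀ n : ℕ, BoolFun n → Prop) : Prop :=
  Tendsto (fun n : ℕ => (Set.ncard {f : BoolFun n | ¬ P n f} : ℝ) / Nat.card (BoolFun n))
    atTop (𝓝 0)

end LocalCorrection

end

open Filter Topology Finset

namespace LocalCorrection

/-- The function obtained from `f` by flipping its values on `S`. -/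
def flipOn {α : Type*} [DecidableEq α] (S : Finset α) (f : α → ZMod 2) : α → ZMod 2 :=
  fun a => if a ∈ S then f a + 1 else f a

section BoundedDifferences

variable {α : Type*} [DecidableEq α]

lemma flipOn_insert {w : α} {S : Finset α} (hw : w ∉ S) (f : α → ZMod 2) :
    flipOn (insert w S) f = flipOn {w} (flipOn S f) := by
  ext a
  by_cases h : a = w
  · subst h; simp [flipOn, hw]
  · simp [flipOn, h]

lemma flipOn_comm (S T : Finset α) (f : α → ZMod 2) :
    flipOn S (flipOn T f) = flipOn T (flipOn S f) := by
  ext a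
  simp only [flipOn]
  split_ifs <;> rfl

lemma flipOn_flipOn (S : Finset α) (f : α → ZMod 2) : flipOn S (flipOn S f) = f := by
  ext a
  simp only [flipOn]
  split_ifs
  · rw [add_assoc, CharTwo.add_self_eq_zero, add_zero]
  · rfl

lemma exp_add_exp_le (a b : ℝ) :
    Real.exp a + Real.exp b ≤ 2 * (Real.exp ((a - b) ^ 2 / 8) * Real.exp ((a + b) / 2)) := by
  have h := Real.cosh_le_exp_half_sq ((a - b) / 2)
  have e : ((a - b) / 2) ^ 2 / 2 = (a - b) ^ 2 / 8 := by ring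
  rw [e, Real.cosh_eq] at h
  have h1 : Real.exp a = Real.exp ((a - b) / 2) * Real.exp ((a + b) / 2) := by
    rw [← Real.exp_add]; congr 1; ring
  have h2 : Real.exp b = Real.exp (-((a - b) / 2)) * Real.exp ((a + b) / 2) := by
    rw [← Real.exp_add]; congr 1; ring
  rw [h1, h2]
  nlinarith [Real.exp_pos ((a + b) / 2)]

variable [Fintype α]

lemma sum_exp_le_sum_exp_average (w : α) (F : (α → ZMod 2) → ℝ) (c : ℝ)
    (hF : ∀ f, |F (flipOn {w} f) - F f| ≤ c) :
    ∑ f, Real.exp (F f) ≤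
      Real.exp (c ^ 2 / 8) * ∑ f, Real.exp ((F f + F (flipOn {w} f)) / 2) := by
  have hinv : Function.Involutive (flipOn {w} : (α → ZMod 2) → α → ZMod 2) := flipOn_flipOn {w}
  have h1 : ∑ f, Real.exp (F (flipOn {w} f)) = ∑ f, Real.exp (F f) :=
    Equiv.sum_comp (hinv.toPerm _) (fun f => Real.exp (F f))
  have h2 : ∑ f, (Real.exp (F f) + Real.exp (F (flipOn {w} f))) ≤
      ∑ f, 2 * (Real.exp (c ^ 2 / 8) * Real.exp ((F f + F (flipOn {w} f)) / 2)) := by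
    refine Finset.sum_le_sum fun f _ => (exp_add_exp_le _ _).trans ?_
    have : (F f - F (flipOn {w} f)) ^ 2 ≤ c ^ 2 := by
      have := hF f
      rw [abs_sub_comm] at this
      exact sq_le_sq' (abs_le.mp this).1 (abs_le.mp this).2
    gcongr
  rw [Finset.sum_add_distrib, h1, ← Finset.mul_sum, ← Finset.mul_sum] at h2
  linarith

/-- The exponential moment of a function of independent bits that has bounded differences in the
bits indexed by `L` is controlled by that of its average over those bits. -/
lemma sum_exp_le_of_bounded_differences (c : ℝ) (L : Finset α) (F : (α → ZMod 2) → ℝ)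
    (hF : ∀ w ∈ L, ∀ f, |F (flipOn {w} f) - F f| ≤ c) :
    ∑ f, Real.exp (F f) ≤ Real.exp (#L * (c ^ 2 / 8)) *
      ∑ f, Real.exp ((∑ S ∈ L.powerset, F (flipOn S f)) / 2 ^ #L) := by
  induction L using Finset.induction_on generalizing F with
  | empty =>
    have h (f : α → ZMod 2) : flipOn ∅ f = f := by ext; simp [flipOn]
    simp [h]
  | insert w L hw ih =>
    refine (sum_exp_le_sum_exp_average w F c (hF w (mem_insert_self w L))).trans ?_
    have key := ih (fun f => (F f + F (flipOn {w} f)) / 2) (by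
      intro v hv f
      have h1 := abs_le.mp (hF v (mem_insert_of_mem hv) f)
      have h2 := abs_le.mp (hF v (mem_insert_of_mem hv) (flipOn {w} f))
      rw [flipOn_comm] at h2
      simp only [abs_le]
      constructor <;> linarith [h1.1, h1.2, h2.1, h2.2])
    have e (f : α → ZMod 2) :
        (∑ S ∈ (insert w L).powerset, F (flipOn S f)) / 2 ^ #(insert w L) =
          (∑ S ∈ L.powerset, (F (flipOn S f) + F (flipOn {w} (flipOn S f))) / 2) / 2 ^ #L := by
      rw [Finset.sum_powerset_insert hw, card_insert_of_notMem hw, ← Finset.sum_div,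
        Finset.sum_add_distrib]
      have : ∑ S ∈ L.powerset, F (flipOn (insert w S) f) =
          ∑ S ∈ L.powerset, F (flipOn {w} (flipOn S f)) := by
        refine Finset.sum_congr rfl fun S hS => ?_
        rw [flipOn_insert fun h => hw (mem_powerset.mp hS h)]
      rw [this, pow_succ, div_div, mul_comm (2 ^ #L : ℝ) 2]
    simp only [e]
    have e2 : Real.exp (#(insert w L) * (c ^ 2 / 8)) =
        Real.exp (c ^ 2 / 8) * Real.exp (#L * (c ^ 2 / 8)) := by
      rw [card_insert_of_notMem hw, ← Real.exp_add]
      congr 1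
      push_cast
      ring
    rw [e2, mul_assoc]
    gcongr

/-- McDiarmid's inequality for independent uniform bits, those outside `L` being conditioned
upon. -/
lemma card_le_of_bounded_differences {c m t : ℝ} (hc : 0 < c) (ht : 0 < t) {L : Finset α}
    (hL : L.Nonempty) (F : (α → ZMod 2) → ℝ)
    (hF : ∀ w ∈ L, ∀ f, |F (flipOn {w} f) - F f| ≤ c)
    (hm : ∀ f, (∑ S ∈ L.powerset, F (flipOn S f)) / 2 ^ #L = m) :
    (#{f | m + t ≤ F f} : ℝ) ≤
      Fintype.card (α → ZMod 2) * Real.exp (-(2 * t ^ 2 / (#L * c ^ 2))) := by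
  have hN : (0 : ℝ) < #L := by exact_mod_cast hL.card_pos
  set l : ℝ := 4 * t / (#L * c ^ 2) with hl
  have hl0 : 0 < l := by positivity
  have h1 := sum_exp_le_of_bounded_differences (l * c) L (fun f => l * F f) (by
    intro w hw f
    rw [← mul_sub, abs_mul, abs_of_pos hl0]
    exact mul_le_mul_of_nonneg_left (hF w hw f) hl0.le)
  simp only [← Finset.mul_sum, mul_div_assoc, hm, sum_const, nsmul_eq_mul, card_univ] at h1
  have h2 : (#{f | m + t ≤ F f} : ℝ) * Real.exp (l * (m + t)) ≤ ∑ f, Real.exp (l * F f) := by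
    rw [← nsmul_eq_mul, ← Finset.sum_const]
    refine (Finset.sum_le_sum fun f hf => ?_).trans
      (Finset.sum_le_univ_sum_of_nonneg fun f => (Real.exp_pos _).le)
    exact Real.exp_le_exp.mpr (mul_le_mul_of_nonneg_left (mem_filter.mp hf).2 hl0.le)
  have h3 := h2.trans h1
  rw [← le_div_iff₀ (Real.exp_pos _)] at h3
  refine h3.trans (le_of_eq ?_)
  rw [mul_left_comm, mul_div_assoc, ← Real.exp_add, ← Real.exp_sub]
  congr 2
  rw [hl]
  field_simp
  ring

end BoundedDifferences

/-- The points of the cube of weight `k`. -/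
def level (n k : ℕ) : Finset (Cube n) := {w | #{i | w i = 1} = k}

lemma mem_level {n k : ℕ} {w : Cube n} : w ∈ level n k ↔ #{i | w i = 1} = k := by
  simp [level]

lemma choose_le_card_level (n k : ℕ) : n.choose k ≤ #(level n k) := by
  have h : #(powersetCard k (univ : Finset (Fin n))) = n.choose k := by simp
  rw [← h]
  refine card_le_card_of_injOn (fun S i => if i ∈ S then 1 else 0) ?_ ?_
  · intro S hS
    have := (mem_powersetCard.mp hS).2
    simp [mem_level, this]
  · intro S _ T _ hST
    ext i
    have := congrFun hST i
    by_cases h1 : i ∈ S <;> by_cases h2 : i ∈ T <;> simp_all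

lemma two_pow_le_card_level (n : ℕ) : 2 ^ n ≤ (n + 1) * #(level n (n / 2)) := by
  calc 2 ^ n = ∑ k ∈ range (n + 1), n.choose k := (Nat.sum_range_choose n).symm
    _ ≤ ∑ _k ∈ range (n + 1), n.choose (n / 2) :=
      Finset.sum_le_sum fun k _ => Nat.choose_le_middle k n
    _ = (n + 1) * n.choose (n / 2) := by simp
    _ ≤ _ := Nat.mul_le_mul_left _ (choose_le_card_level n _)

lemma level_nonempty (n : ℕ) : (level n (n / 2)).Nonempty := by
  rw [← card_pos]
  by_contra h
  have := two_pow_le_card_level n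
  have h2 : 0 < 2 ^ n := by positivity
  simp_all

lemma comp_perm_mem_level {n k : ℕ} {w : Cube n} (τ : Equiv.Perm (Fin n)) :
    w ∘ τ ∈ level n k ↔ w ∈ level n k := by
  rw [mem_level, mem_level]
  have : #{i | (w ∘ τ) i = 1} = #{i | w i = 1} :=
    card_bij (fun i _ => τ i) (by simp) (by simp) (fun b hb => ⟨τ.symm b, by simpa using hb⟩)
  rw [this]

lemma exists_perm_of_mem_level {n k : ℕ} {v w : Cube n} (hv : v ∈ level n k)
    (hw : w ∈ level n k) : ∃ τ : Equiv.Perm (Fin n), v ∘ τ = w := by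
  rw [mem_level] at hv hw
  have e : {i // w i = 1} ≃ {i // v i = 1} := Fintype.equivOfCardEq (by
    rw [Fintype.card_subtype, Fintype.card_subtype, hv, hw])
  refine ⟨e.extendSubtype, funext fun i => ?_⟩
  have two (a : ZMod 2) : a ≠ 1 → a = 0 := by revert a; decide
  by_cases h : w i = 1
  · rw [Function.comp_apply, e.extendSubtype_mem i h, h]
  · rw [Function.comp_apply, two _ (e.extendSubtype_not_mem i h), two _ h]

/-- A permutation sends a given point to a given point of a level for at most a
`1 / #level` fraction of the permutations. -/
lemma card_perm_mul_card_level_le {n k : ℕ} (z w : Cube n) (hw : w ∈ level n k) :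
    #{σ : Equiv.Perm (Fin n) | z ∘ σ = w} * #(level n k) ≤ n.factorial := by
  have h (v : Cube n) (hv : v ∈ level n k) :
      #{σ : Equiv.Perm (Fin n) | z ∘ σ = w} ≤ #{σ : Equiv.Perm (Fin n) | z ∘ σ = v} := by
    obtain ⟨τ, rfl⟩ := exists_perm_of_mem_level hw hv
    refine card_le_card_of_injOn (fun σ => σ * τ) ?_ (fun a _ b _ hab => mul_right_cancel hab)
    intro σ hσ
    have hσ : z ∘ σ = w := by simpa using hσ
    simp [← hσ, Function.comp_assoc]
  calc #{σ : Equiv.Perm (Fin n) | z ∘ σ = w} * #(level n k)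
      = ∑ _v ∈ level n k, #{σ : Equiv.Perm (Fin n) | z ∘ σ = w} := by simp [mul_comm]
    _ ≤ ∑ v ∈ level n k, #{σ : Equiv.Perm (Fin n) | z ∘ σ = v} := Finset.sum_le_sum h
    _ ≤ ∑ v : Cube n, #{σ : Equiv.Perm (Fin n) | z ∘ σ = v} :=
      Finset.sum_le_univ_sum_of_nonneg fun _ => Nat.zero_le _
    _ = #(univ : Finset (Equiv.Perm (Fin n))) :=
      (card_eq_sum_card_fiberwise fun _ _ => by simp).symm
    _ = n.factorial := by simp [Fintype.card_perm]

/-- The event that `D` recovers `f_σ(x)` from the copy `f_σ` whose value at `x` is erased. -/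
def Recovers {n q : ℕ} (D : NonAdaptive n q) (x : Cube n) (f : BoolFun n)
    (σ : Equiv.Perm (Fin n)) : Prop :=
  D.run (Function.update (isoCopy f σ) x 0) = isoCopy f σ x

instance {n q : ℕ} (D : NonAdaptive n q) (x : Cube n) (f : BoolFun n) :
    DecidablePred (Recovers D x f) := fun _ => inferInstanceAs (Decidable (_ = _))

/-- The fraction of the permutations `σ` for which `D` recovers `f_σ(x)`. -/
noncomputable def recoveryRate {n q : ℕ} (D : NonAdaptive n q) (x : Cube n) (f : BoolFun n) : ℝ :=
  (∑ σ, if Recovers D x f σ then 1 else 0) / n.factorial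

lemma recovers_flipOn {n q : ℕ} (D : NonAdaptive n q) (x : Cube n) (f : BoolFun n)
    (σ : Equiv.Perm (Fin n)) : Recovers D x (flipOn {x ∘ σ} f) σ ↔ ¬ Recovers D x f σ := by
  have h1 : Function.update (isoCopy (flipOn {x ∘ σ} f) σ) x 0 =
      Function.update (isoCopy f σ) x 0 := by
    ext y
    by_cases h : y = x
    · simp [h]
    · have : y ∘ σ ≠ x ∘ σ := fun e => h (σ.surjective.injective_comp_right e)
      simp only [Function.update_of_ne h, isoCopy, flipOn, mem_singleton]
      exact if_neg this
  have h2 : isoCopy (flipOn {x ∘ σ} f) σ x = isoCopy f σ x + 1 := by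
    simp only [isoCopy, flipOn, mem_singleton]
    exact if_pos rfl
  have two (a b : ZMod 2) : a = b + 1 ↔ ¬ a = b := by revert a b; decide
  rw [Recovers, Recovers, h1, h2, two]

lemma sum_powerset_recoveryRate {n q k : ℕ} (D : NonAdaptive n q) {x : Cube n}
    (hx : x ∈ level n k) (f : BoolFun n) :
    (∑ S ∈ (level n k).powerset, recoveryRate D x (flipOn S f)) / 2 ^ #(level n k) = 1 / 2 := by
  have key (σ : Equiv.Perm (Fin n)) : ∑ S ∈ (level n k).powerset,
      (if Recovers D x (flipOn S f) σ then (1 : ℝ) else 0) = 2 ^ #(level n k) / 2 := by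
    set w := x ∘ σ with hw
    have hwL : w ∈ level n k := (comp_perm_mem_level σ).mpr hx
    have hn : w ∉ (level n k).erase w := notMem_erase _ _
    rw [← insert_erase hwL, Finset.sum_powerset_insert hn, ← Finset.sum_add_distrib,
      card_insert_of_notMem hn]
    have : ∀ S ∈ ((level n k).erase w).powerset,
        ((if Recovers D x (flipOn S f) σ then (1 : ℝ) else 0) +
          if Recovers D x (flipOn (insert w S) f) σ then (1 : ℝ) else 0) = 1 := by
      intro S hS
      rw [flipOn_insert (fun h => hn (mem_powerset.mp hS h))]
      simp only [hw, recovers_flipOn]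
      by_cases h : Recovers D x (flipOn S f) σ <;> simp [h]
    rw [Finset.sum_congr rfl this]
    simp [pow_succ]
  simp only [recoveryRate]
  rw [← Finset.sum_div, Finset.sum_comm]
  simp only [key]
  have : (n.factorial : ℝ) ≠ 0 := by positivity
  simp [Fintype.card_perm]
  field_simp

lemma recovers_flipOn_of_ne {n q : ℕ} (D : NonAdaptive n q) (x w : Cube n) (f : BoolFun n)
    (σ : Equiv.Perm (Fin n)) (hx : x ∘ σ ≠ w) (hD : ∀ j, D.query j ∘ σ ≠ w) :
    Recovers D x (flipOn {w} f) σ ↔ Recovers D x f σ := by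
  have h (y : Cube n) (hy : y ∘ σ ≠ w) : isoCopy (flipOn {w} f) σ y = isoCopy f σ y := by
    simp only [isoCopy, flipOn, mem_singleton]
    exact if_neg hy
  have h2 : D.run (Function.update (isoCopy (flipOn {w} f) σ) x 0) =
      D.run (Function.update (isoCopy f σ) x 0) := by
    simp only [NonAdaptive.run]
    congr 1
    ext j
    simp only [Function.update_apply, h _ (hD j)]
  rw [Recovers, Recovers, h2, h x hx]

lemma abs_recoveryRate_flipOn_sub_le {n q k : ℕ} (D : NonAdaptive n q) (x w : Cube n)
    (hw : w ∈ level n k) (f : BoolFun n) :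
    |recoveryRate D x (flipOn {w} f) - recoveryRate D x f| ≤ (q + 1) / #(level n k) := by
  have hL : (0 : ℝ) < #(level n k) := by exact_mod_cast card_pos.mpr ⟨w, hw⟩
  have hfac : (0 : ℝ) < n.factorial := by positivity
  have hcount (z : Cube n) : (∑ σ : Equiv.Perm (Fin n), if z ∘ σ = w then (1 : ℝ) else 0) ≤
      n.factorial / #(level n k) := by
    rw [le_div_iff₀ hL, Finset.sum_boole]
    exact_mod_cast card_perm_mul_card_level_le z w hw
  have hpt (σ : Equiv.Perm (Fin n)) :
      |(if Recovers D x (flipOn {w} f) σ then (1 : ℝ) else 0) -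
        if Recovers D x f σ then (1 : ℝ) else 0| ≤
      (if x ∘ σ = w then (1 : ℝ) else 0) + ∑ j, if D.query j ∘ σ = w then (1 : ℝ) else 0 := by
    have h0 : 0 ≤ ∑ j, if D.query j ∘ σ = w then (1 : ℝ) else 0 :=
      Finset.sum_nonneg fun j _ => by split_ifs <;> norm_num
    have h1 : |(if Recovers D x (flipOn {w} f) σ then (1 : ℝ) else 0) -
        if Recovers D x f σ then (1 : ℝ) else 0| ≤ 1 := by
      split_ifs <;> norm_num
    by_cases hx : x ∘ σ = w
    · rw [if_pos hx]; linarith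
    rw [if_neg hx, zero_add]
    by_cases hD : ∃ j, D.query j ∘ σ = w
    · obtain ⟨j, hj⟩ := hD
      refine h1.trans ?_
      have := Finset.single_le_sum (f := fun j => if D.query j ∘ σ = w then (1 : ℝ) else 0)
        (fun i _ => by split_ifs <;> norm_num) (mem_univ j)
      simpa [hj] using this
    · simp only [not_exists] at hD
      rw [if_congr (recovers_flipOn_of_ne D x w f σ hx hD) rfl rfl, sub_self, abs_zero]
      exact h0
  rw [recoveryRate, recoveryRate, ← sub_div, abs_div, abs_of_pos hfac, div_le_iff₀ hfac,
    ← Finset.sum_sub_distrib]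
  refine (Finset.abs_sum_le_sum_abs _ _).trans ((Finset.sum_le_sum fun σ _ => hpt σ).trans ?_)
  rw [Finset.sum_add_distrib, Finset.sum_comm]
  have := Finset.sum_le_sum fun (j : Fin q) (_ : j ∈ univ) => hcount (D.query j)
  rw [Finset.sum_const, card_univ, Fintype.card_fin, nsmul_eq_mul] at this
  calc _ ≤ (n.factorial / #(level n k) : ℝ) + q * (n.factorial / #(level n k)) :=
        add_le_add (hcount x) this
    _ = _ := by ring

lemma card_recoveryRate_le {n q k : ℕ} (D : NonAdaptive n q) {x : Cube n} (hx : x ∈ level n k) :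
    (#{f | 2 / 3 ≤ recoveryRate D x f} : ℝ) ≤
      Fintype.card (BoolFun n) * Real.exp (-(#(level n k) / (18 * (q + 1) ^ 2))) := by
  have hL : (0 : ℝ) < #(level n k) := by exact_mod_cast card_pos.mpr ⟨x, hx⟩
  have h := card_le_of_bounded_differences (c := (q + 1) / #(level n k)) (m := 1 / 2)
    (t := 1 / 6) (by positivity) (by norm_num) ⟨x, hx⟩ (recoveryRate D x)
    (fun w hw f => abs_recoveryRate_flipOn_sub_le D x w hw f) (sum_powerset_recoveryRate D hx)
  have e1 : (1 / 2 + 1 / 6 : ℝ) = 2 / 3 := by norm_num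
  have e2 : (2 * (1 / 6) ^ 2 / (#(level n k) * ((q + 1) / #(level n k)) ^ 2) : ℝ) =
      #(level n k) / (18 * (q + 1) ^ 2) := by
    field_simp
    norm_num
  rwa [e1, e2] at h

/-- A deterministic non-adaptive procedure is a pair of a query vector and an output function. -/
def nonAdaptiveEquiv (n q : ℕ) :
    NonAdaptive n q ≃ (Fin q → Cube n) × ((Fin q → ZMod 2) → ZMod 2) where
  toFun D := (D.query, D.answer)
  invFun p := ⟨p.1, p.2⟩
  left_inv _ := rfl
  right_inv _ := rfl

instance (n q : ℕ) : Fintype (NonAdaptive n q) := Fintype.ofEquiv _ (nonAdaptiveEquiv n q).symm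

lemma card_nonAdaptive (n q : ℕ) : Fintype.card (NonAdaptive n q) = 2 ^ (n * q + 2 ^ q) := by
  rw [Fintype.card_congr (nonAdaptiveEquiv n q)]
  simp [ZMod.card, pow_add, pow_mul]

lemma isClose_update {n : ℕ} (f : BoolFun n) (x : Cube n) (b : ZMod 2) :
    IsClose ((2 : ℝ) ^ n)⁻¹ (Function.update f x b) f := by
  have h : Set.ncard {y : Cube n | Function.update f x b y ≠ f y} ≤ 1 := by
    rw [← Set.ncard_singleton x]
    refine Set.ncard_le_ncard (fun y hy => ?_) (Set.finite_singleton x)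
    by_contra hne
    exact hy (Function.update_of_ne hne _ _)
  rw [IsClose, inv_eq_one_div]
  gcongr
  exact_mod_cast h

lemma LocallyCorrectable.exists_recoveryRate {n q : ℕ} {f : BoolFun n}
    (hf : LocallyCorrectable f q ((2 : ℝ) ^ n)⁻¹) (x : Cube n) :
    ∃ D : NonAdaptive n q, 2 / 3 ≤ recoveryRate D x f := by
  obtain ⟨A, hA⟩ := hf
  have hne (D : NonAdaptive n q) : A x D ≠ ⊤ := (A x).apply_ne_top D
  have hsum : ∑ D, (A x D).toReal = 1 := by
    rw [← ENNReal.toReal_sum fun D _ => hne D, ← tsum_fintype (L := .unconditional _),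
      (A x).tsum_coe, ENNReal.toReal_one]
  have hσ (σ : Equiv.Perm (Fin n)) :
      2 / 3 ≤ ∑ D, (A x D).toReal * if Recovers D x f σ then 1 else 0 := by
    have h := hA σ _ (isClose_update (isoCopy f σ) x 0) x
    rw [RandNonAdaptive.output, PMF.map_apply, tsum_fintype] at h
    have h' := ENNReal.toReal_mono (ENNReal.sum_ne_top.mpr fun D _ => by
      split_ifs
      exacts [hne D, ENNReal.zero_ne_top]) h
    rw [ENNReal.toReal_sum fun D _ => by
      split_ifs
      exacts [hne D, ENNReal.zero_ne_top]] at h'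
    have e : ((2 / 3 : ENNReal)).toReal = 2 / 3 := by simp
    rw [e] at h'
    refine h'.trans (le_of_eq (Finset.sum_congr rfl fun D _ => ?_))
    by_cases hr : Recovers D x f σ
    · rw [if_pos hr, if_pos (Eq.symm hr), mul_one]
    · rw [if_neg hr, if_neg (fun e => hr (Eq.symm e)), mul_zero, ENNReal.toReal_zero]
  have hfac : (0 : ℝ) < n.factorial := by positivity
  have havg : 2 / 3 ≤ ∑ D, (A x D).toReal * recoveryRate D x f := by
    have h := Finset.sum_le_sum fun σ (_ : σ ∈ univ) => hσ σ
    rw [Finset.sum_comm] at h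
    simp only [← Finset.mul_sum, sum_const, card_univ, Fintype.card_perm, Fintype.card_fin,
      nsmul_eq_mul] at h
    simp only [recoveryRate, ← mul_div_assoc]
    rw [← Finset.sum_div, le_div_iff₀ hfac]
    linarith
  by_contra! hlt
  obtain ⟨D₀, hD₀⟩ : ∃ D, 0 < (A x D).toReal := by
    by_contra! h
    have := Finset.sum_nonpos fun D (_ : D ∈ univ) => h D
    linarith
  have : ∑ D, (A x D).toReal * recoveryRate D x f < ∑ D, (A x D).toReal * (2 / 3) :=
    Finset.sum_lt_sum
      (fun D _ => mul_le_mul_of_nonneg_left (hlt D).le ENNReal.toReal_nonneg)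
      ⟨D₀, mem_univ _, mul_lt_mul_of_pos_left (hlt D₀) hD₀⟩
  rw [← Finset.sum_mul, hsum] at this
  linarith

lemma ncard_locallyCorrectable_le (n q : ℕ) :
    (Set.ncard {f : BoolFun n | LocallyCorrectable f q ((2 : ℝ) ^ n)⁻¹} : ℝ) ≤
      2 ^ (n * q + 2 ^ q) * (Fintype.card (BoolFun n) *
        Real.exp (-(#(level n (n / 2)) / (18 * (q + 1) ^ 2)))) := by
  obtain ⟨x, hx⟩ := level_nonempty n
  have hsub : {f : BoolFun n | LocallyCorrectable f q ((2 : ℝ) ^ n)⁻¹} ⊆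
      ↑((univ : Finset (NonAdaptive n q)).biUnion
        fun D => {f : BoolFun n | 2 / 3 ≤ recoveryRate D x f}) := by
    intro f hf
    obtain ⟨D, hD⟩ := LocallyCorrectable.exists_recoveryRate hf x
    simpa using ⟨D, hD⟩
  have h1 := Set.ncard_le_ncard hsub (Finset.finite_toSet _)
  rw [Set.ncard_coe_finset] at h1
  have h2 := h1.trans card_biUnion_le
  calc _ ≤ ((∑ D : NonAdaptive n q, #{f | 2 / 3 ≤ recoveryRate D x f} : ℕ) : ℝ) := by
        exact_mod_cast h2
    _ ≤ ∑ _D : NonAdaptive n q, Fintype.card (BoolFun n) *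
        Real.exp (-(#(level n (n / 2)) / (18 * (q + 1) ^ 2))) := by
        push_cast
        exact Finset.sum_le_sum fun D _ => card_recoveryRate_le D hx
    _ = _ := by simp [card_nonAdaptive]

lemma ncard_locallyCorrectable_le_exp {n q : ℕ} (hq : 2 * q ≤ n) :
    (Set.ncard {f : BoolFun n | LocallyCorrectable f q ((2 : ℝ) ^ n)⁻¹} : ℝ) ≤
      Fintype.card (BoolFun n) * Real.exp
        ((n : ℝ) ^ 2 + √2 ^ n - (√2 ^ n) ^ 2 / (18 * ((n : ℝ) + 1) ^ 3)) := by
  refine (ncard_locallyCorrectable_le n q).trans ?_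
  have h2 : (1 : ℝ) ≤ √2 := Real.one_le_sqrt.mpr (by norm_num)
  have hs : (√2 ^ n) ^ 2 = (2 : ℝ) ^ n := by
    rw [← pow_mul, mul_comm, pow_mul, Real.sq_sqrt (by norm_num)]
  have hqs : (2 : ℝ) ^ q ≤ √2 ^ n := by
    calc (2 : ℝ) ^ q = √2 ^ (2 * q) := by rw [pow_mul, Real.sq_sqrt (by norm_num)]
      _ ≤ _ := pow_le_pow_right₀ h2 hq
  have hqn : (q : ℝ) ≤ n := by exact_mod_cast (by omega : q ≤ n)
  have ha : (2 : ℝ) ^ (n * q + 2 ^ q) ≤ Real.exp ((n : ℝ) ^ 2 + √2 ^ n) := by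
    calc (2 : ℝ) ^ (n * q + 2 ^ q) ≤ Real.exp 1 ^ (n * q + 2 ^ q) :=
          pow_le_pow_left₀ (by norm_num) (by linarith [Real.add_one_le_exp 1]) _
      _ = Real.exp ((n : ℝ) * q + 2 ^ q) := by rw [← Real.exp_nat_mul]; push_cast; simp
      _ ≤ _ := by
        apply Real.exp_le_exp.mpr
        nlinarith [mul_le_mul_of_nonneg_left hqn (Nat.cast_nonneg (α := ℝ) n)]
  have hb : (√2 ^ n) ^ 2 / (18 * ((n : ℝ) + 1) ^ 3) ≤
      #(level n (n / 2)) / (18 * ((q : ℝ) + 1) ^ 2) := by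
    have hl : (2 : ℝ) ^ n ≤ (n + 1) * #(level n (n / 2)) := by
      exact_mod_cast two_pow_le_card_level n
    rw [hs]
    calc (2 : ℝ) ^ n / (18 * ((n : ℝ) + 1) ^ 3)
        ≤ (n + 1) * #(level n (n / 2)) / (18 * ((n : ℝ) + 1) ^ 3) := by gcongr
      _ = #(level n (n / 2)) / (18 * ((n : ℝ) + 1) ^ 2) := by field_simp
      _ ≤ _ := by gcongr
  rw [mul_left_comm, sub_eq_add_neg, Real.exp_add]
  gcongr

lemma tendsto_union_bound : Tendsto (fun n : ℕ => ((n : ℝ) + 1) * Real.exp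
    ((n : ℝ) ^ 2 + √2 ^ n - (√2 ^ n) ^ 2 / (18 * ((n : ℝ) + 1) ^ 3))) atTop (𝓝 0) := by
  have h1 : (1 : ℝ) < √2 := Real.lt_sqrt_of_sq_lt (by norm_num)
  have hT (k : ℕ) : Tendsto (fun n : ℕ => (n : ℝ) ^ k / √2 ^ n) atTop (𝓝 0) :=
    tendsto_pow_const_div_const_pow_of_one_lt k h1
  have hlim : Tendsto (fun n : ℕ => ((n : ℝ) + 1) / √2 ^ n) atTop (𝓝 0) := by
    simpa [add_div] using (hT 1).add (hT 0)
  refine squeeze_zero' (Eventually.of_forall fun n => by positivity) ?_ hlim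
  filter_upwards [(hT 6).eventually (gt_mem_nhds (by norm_num : (0 : ℝ) < 1 / 1000)),
    eventually_ge_atTop 1] with n hn hn1
  have hn1 : (1 : ℝ) ≤ n := by exact_mod_cast hn1
  set s := √2 ^ n with hs
  have hs1 : 1 ≤ s := one_le_pow₀ h1.le
  have hs0 : 0 < s := by linarith
  rw [div_lt_iff₀ hs0] at hn
  have hpoly : (2 + (n : ℝ) ^ 2) * (18 * ((n : ℝ) + 1) ^ 3) ≤ s := by
    have a : ((n : ℝ) + 1) ^ 3 ≤ (2 * n) ^ 3 := by gcongr; linarith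
    have b : 2 + (n : ℝ) ^ 2 ≤ 3 * (n : ℝ) ^ 2 := by nlinarith
    have d : (n : ℝ) ^ 5 ≤ n ^ 6 := pow_le_pow_right₀ hn1 (by norm_num)
    calc _ ≤ 3 * (n : ℝ) ^ 2 * (18 * (2 * n) ^ 3) := by gcongr
      _ = 432 * (n : ℝ) ^ 5 := by ring
      _ ≤ s := by linarith
  have hdiv : (2 + (n : ℝ) ^ 2) * s ≤ s ^ 2 / (18 * ((n : ℝ) + 1) ^ 3) := by
    rw [le_div_iff₀ (by positivity)]
    nlinarith
  have hexp : (n : ℝ) ^ 2 + s - s ^ 2 / (18 * ((n : ℝ) + 1) ^ 3) ≤ -s := by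
    nlinarith [sq_nonneg (n : ℝ)]
  rw [div_eq_mul_inv]
  refine mul_le_mul_of_nonneg_left ((Real.exp_le_exp.mpr hexp).trans ?_) (by positivity)
  rw [Real.exp_neg]
  gcongr
  linarith [Real.add_one_le_exp s]

end LocalCorrection

open LocalCorrection in
theorem theorem3 :
    LocalCorrection.AlmostEveryBoolFun (fun n f =>
      ∀ q : ℕ, (q : ℝ) < (n : ℝ) / 100 →
        ¬ LocalCorrection.LocallyCorrectable f q ((2 : ℝ) ^ n)⁻¹) := by
  refine squeeze_zero (fun n => by positivity) (fun n => ?_) tendsto_union_bound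
  have hpos : (0 : ℝ) < Nat.card (BoolFun n) := by exact_mod_cast Nat.card_pos
  rw [div_le_iff₀ hpos, Nat.card_eq_fintype_card]
  have hsub : {f : BoolFun n | ¬ ∀ q : ℕ, (q : ℝ) < (n : ℝ) / 100 →
      ¬ LocallyCorrectable f q ((2 : ℝ) ^ n)⁻¹} ⊆
      ⋃ q ∈ range (n / 2 + 1), {f : BoolFun n | LocallyCorrectable f q ((2 : ℝ) ^ n)⁻¹} := by
    intro f hf
    simp only [Set.mem_ofPred_eq, not_forall, not_not] at hf
    obtain ⟨q, hq, hf⟩ := hf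
    have hq' : (2 * q : ℝ) ≤ n := by
      have : (0 : ℝ) ≤ q := Nat.cast_nonneg q
      linarith
    have hq' : 2 * q ≤ n := by exact_mod_cast hq'
    simp only [Set.mem_iUnion, mem_range]
    exact ⟨q, by omega, hf⟩
  have h1 := (Set.ncard_le_ncard hsub (Set.toFinite _)).trans (Finset.set_ncard_biUnion_le _ _)
  have h2 := Finset.sum_le_sum fun q (hq : q ∈ range (n / 2 + 1)) =>
    ncard_locallyCorrectable_le_exp (n := n) (q := q) (by have := mem_range.mp hq; omega)
  rw [Finset.sum_const, card_range, nsmul_eq_mul] at h2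
  refine (Nat.cast_le.mpr h1).trans ?_
  rw [Nat.cast_sum]
  refine h2.trans ?_
  have : ((n / 2 + 1 : ℕ) : ℝ) ≤ n + 1 := by exact_mod_cast (by omega : n / 2 + 1 ≤ n + 1)
  rw [mul_left_comm, mul_comm (Fintype.card (BoolFun n) : ℝ)]
  gcongr
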